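/- Let $\ell^2$ be the complex Hilbert space of square summable sequences indexed by $\{0,1,2,\dots\}$ with standard orthonormal basis $\{e_n\}_{n\ge 0}$. For a bounded sequence $\boldsymbol\lambda=\{\lambda_n\}_{n=0}^\infty\subseteq(0,\infty)$, let $W_{\boldsymbol\lambda}$ be the unilateral weighted shift on $\ell^2$, that is, the bounded operator with $W_{\boldsymbol\lambda}e_n=\lambda_n e_{n+1}$ for all $n\ge 0$, and put $\beta_n=1-2\lambda_n^2+\lambda_n^2\lambda_{n+1}^2$ for $n\ge 0$. A real sequence $\{\gamma_n\}_{n=0}^\infty$ is conditionally positive definite if $\sum_{i,j=0}^{m}\gamma_{i+j}c_i\bar c_j\ge 0$ for all $m\ge 0$ and all $c_0,\dots,c_m\in\mathbb C$ with $\sum_{j=0}^m c_j=0$; a bounded operator $T$ on a complex Hilbert space $\mathcal H$ is conditionally positive definite (CPD) if the sequence $\{\|T^nh\|^2\}_{n=0}^\infty$ is conditionally positive definite for every $h\in\mathcal H$; and $T$ is a $2$-isometry if $I-2T^*T+T^{*2}T^2=0$. For $a\in(0,\infty)$ and $b\in[1,\infty)$, let $W_{a,b}$ be the unilateral weighted shift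 on $\ell^2$ with weights $\lambda_0=\sqrt a$ and $\lambda_n=\sqrt{\frac{1+n(b-1)}{1+(n-1)(b-1)}}$ for $n\ge 1$. Suppose that $W_{\boldsymbol\lambda}$ is CPD and let $k\ge 0$ be an integer. Then the following conditions are equivalent: (i) $\beta_k=0$; (ii) the restriction $W_{\boldsymbol\lambda}|_{\mathcal M_k}$ of $W_{\boldsymbol\lambda}$ to its invariant subspace $\mathcal M_k$, the closed linear span of $\{e_j: j\ge k\}$, is a $2$-isometry. Moreover, if $\beta_k=0$, then $\beta_j=0$ for every integer $j\ge 1$, and $W_{\boldsymbol\lambda}=W_{a,b}$ for some $a\in(0,\infty)$ and $b\in[1,\infty)$ satisfying $1-2a+ab\ge 0$. -/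

import Mathlib

open scoped ComplexOrder

noncomputable section

namespace CPDShift

/-- A real sequence `γ` is conditionally positive definite:
`∑_{i,j=0}^k γ_{i+j} c_i conj(c_j) ≥ 0` for all complex `c_0, …, c_k` with `∑ c_j = 0`.
(For complex numbers, `0 ≤ z` means that `z` is real and nonnegative.) -/
def IsCPDSeq (γ : ℕ → ℝ) : Prop :=
  ∀ (k : ℕ) (c : Fin (k + 1) → ℂ), ∑ j, c j = 0 →
    0 ≤ ∑ i : Fin (k + 1), ∑ j : Fin (k + 1), (γ ((i : ℕ) + (j : ℕ)) : ℂ) * c i * (starRingEnd ℂ) (c j)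

section Operators

variable {H : Type*} [NormedAddCommGroup H] [InnerProductSpace ℂ H]

/-- A bounded operator `T` is conditionally positive definite if `(‖Tⁿ h‖²)ₙ` is a conditionally
positive definite sequence for every vector `h`. -/
def IsCPDOperator (T : H →L[ℂ] H) : Prop :=
  ∀ h : H, IsCPDSeq fun n => ‖(T ^ n) h‖ ^ 2

variable [CompleteSpace H]

/-- `B_m(T) = ∑_{k=0}^m (-1)^k (m choose k) T*^k T^k`. -/
def defectOp (m : ℕ) (T : H →L[ℂ] H) : H →L[ℂ] H :=
  ∑ k ∈ Finset.range (m + 1),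
    ((-1 : ℂ) ^ k * (m.choose k : ℂ)) • ((ContinuousLinearMap.adjoint T) ^ k * T ^ k)

/-- `T` is an `m`-isometry if `B_m(T) = 0`. -/
def IsMIsometry (m : ℕ) (T : H →L[ℂ] H) : Prop :=
  defectOp m T = 0

end Operators

/-- The Hilbert space of square summable complex sequences indexed by `0, 1, 2, …`. -/
abbrev Ell2 : Type := lp (fun _ : ℕ => ℂ) 2

/-- The standard orthonormal basis vector `e_n` of `ℓ²`. -/
def stdBasis (n : ℕ) : Ell2 := lp.single 2 n (1 : ℂ)

/-- The sequence `(0, w₀ x₀, w₁ x₁, …)`. -/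
def shiftFun (w : ℕ → ℝ) (x : ℕ → ℂ) : ℕ → ℂ
  | 0 => 0
  | n + 1 => (w n : ℂ) * x n

theorem shiftFun_bound {w : ℕ → ℝ} (hpos : ∀ n, 0 < w n) {C : ℝ}
    (hC : ∀ n, w n ≤ C) (x : Ell2) :
    Summable (fun n => ‖shiftFun w x n‖ ^ (2 : ℝ)) ∧
      ∑' n, ‖shiftFun w x n‖ ^ (2 : ℝ) ≤ (C * ‖x‖) ^ (2 : ℝ) := by
  have hx : HasSum (fun n => ‖x n‖ ^ (2 : ℝ)) (‖x‖ ^ (2 : ℝ)) := by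
    have := lp.hasSum_norm (p := 2) (by norm_num) x
    simpa using this
  have hle : ∀ n, ‖shiftFun w x (n + 1)‖ ^ (2 : ℝ) ≤ C ^ (2 : ℝ) * ‖x n‖ ^ (2 : ℝ) := by
    intro n
    have h0 : 0 ≤ C := (hpos 0).le.trans (hC 0)
    rw [← Real.mul_rpow h0 (norm_nonneg _)]
    refine Real.rpow_le_rpow (norm_nonneg _) ?_ (by norm_num)
    simp only [shiftFun, norm_mul, Complex.norm_real, Real.norm_eq_abs, abs_of_pos (hpos n)]
    exact mul_le_mul_of_nonneg_right (hC n) (norm_nonneg _)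
  have hs1 : Summable fun n => ‖shiftFun w x (n + 1)‖ ^ (2 : ℝ) :=
    Summable.of_nonneg_of_le (fun n => by positivity) hle (hx.summable.mul_left _)
  have hs : Summable (fun n => ‖shiftFun w x n‖ ^ (2 : ℝ)) :=
    (summable_nat_add_iff (f := fun n => ‖shiftFun w x n‖ ^ (2 : ℝ)) 1).1 hs1
  refine ⟨hs, ?_⟩
  rw [hs.tsum_eq_zero_add, Real.mul_rpow ((hpos 0).le.trans (hC 0)) (norm_nonneg _),
    ← hx.tsum_eq, ← tsum_mul_left]
  simpa [shiftFun] using hs1.tsum_le_tsum hle (hx.summable.mul_left _)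

/-- The unilateral weighted shift with bounded positive weights `w`: the bounded operator
`(x₀, x₁, …) ↦ (0, w₀ x₀, w₁ x₁, …)` on `ℓ²`. -/
def weightedShift (w : ℕ → ℝ) (hpos : ∀ n, 0 < w n) (hbdd : BddAbove (Set.range w)) :
    Ell2 →L[ℂ] Ell2 :=
  LinearMap.mkContinuousOfExistsBound
    { toFun := fun x => ⟨shiftFun w x, memℓp_gen (by
        obtain ⟨C, hC⟩ := hbdd
        simpa using (shiftFun_bound hpos (fun n => hC ⟨n, rfl⟩) x).1)⟩
      map_add' := fun x y => by
        ext n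
        change shiftFun w _ n = shiftFun w x n + shiftFun w y n
        cases n <;> simp [shiftFun, mul_add]
      map_smul' := fun c x => by
        ext n
        change shiftFun w _ n = c * shiftFun w x n
        cases n <;> simp [shiftFun, mul_left_comm] }
    (by
      obtain ⟨C, hC⟩ := hbdd
      refine ⟨C, fun x => ?_⟩
      have hC' : ∀ n, w n ≤ C := fun n => hC ⟨n, rfl⟩
      refine lp.norm_le_of_tsum_le (by norm_num)
        (mul_nonneg ((hpos 0).le.trans (hC' 0)) (norm_nonneg _)) ?_
      simpa using (shiftFun_bound hpos hC' x).2)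

theorem weightedShift_apply (w : ℕ → ℝ) (hpos : ∀ n, 0 < w n) (hbdd : BddAbove (Set.range w))
    (x : Ell2) (n : ℕ) : weightedShift w hpos hbdd x n = shiftFun w x n := rfl

/-- The defining relation `W e_n = w_n e_{n+1}`. -/
theorem weightedShift_stdBasis (w : ℕ → ℝ) (hpos : ∀ n, 0 < w n)
    (hbdd : BddAbove (Set.range w)) (n : ℕ) :
    weightedShift w hpos hbdd (stdBasis n) = (w n : ℂ) • stdBasis (n + 1) := by
  ext m
  rw [weightedShift_apply, lp.coeFn_smul, Pi.smul_apply, smul_eq_mul]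
  rcases m with _ | m
  · simp [shiftFun, stdBasis, lp.single_apply]
  · rcases eq_or_ne m n with rfl | h
    · simp [shiftFun, stdBasis, lp.single_apply]
    · simp [shiftFun, stdBasis, lp.single_apply, h]

/-- The closed linear span of `{e_j : j ≥ k}`. -/
abbrev tailSpace (k : ℕ) : Submodule ℂ Ell2 :=
  (Submodule.span ℂ (stdBasis '' Set.Ici k)).topologicalClosure

/-- The closed span of `{e_j : j ≥ k}` is invariant for every weighted shift. -/
theorem weightedShift_mem_tailSpace (w : ℕ → ℝ) (hpos : ∀ n, 0 < w n)
    (hbdd : BddAbove (Set.range w)) (k : ℕ) :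
    ∀ x ∈ tailSpace k, weightedShift w hpos hbdd x ∈ tailSpace k := by
  set S := Submodule.span ℂ (stdBasis '' Set.Ici k) with hS
  have h1 : ∀ x ∈ S, weightedShift w hpos hbdd x ∈ S := by
    intro x hx
    induction hx using Submodule.span_induction with
    | mem x hx =>
      obtain ⟨j, hj, rfl⟩ := hx
      rw [weightedShift_stdBasis]
      exact S.smul_mem _ (Submodule.subset_span ⟨j + 1, Nat.le_succ_of_le hj, rfl⟩)
    | zero => simp
    | add x y _ _ hx hy => rw [map_add]; exact S.add_mem hx hy
    | smul c x _ hx => rw [map_smul]; exact S.smul_mem _ hx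
  intro x hx
  exact map_mem_closure (weightedShift w hpos hbdd).continuous hx h1

/-- `β_n = 1 - 2 w_n² + w_n² w_{n+1}²`. -/
def beta (w : ℕ → ℝ) (n : ℕ) : ℝ :=
  1 - 2 * w n ^ 2 + w n ^ 2 * w (n + 1) ^ 2

/-- The weights of `W_{a,b}`: `√a` for `n = 0`, and
`√((1 + n(b-1)) / (1 + (n-1)(b-1)))` for `n ≥ 1`. -/
def abWeights (a b : ℝ) (n : ℕ) : ℝ :=
  if n = 0 then √a else √((1 + (n : ℝ) * (b - 1)) / (1 + ((n : ℝ) - 1) * (b - 1)))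

theorem abWeights_pos {a b : ℝ} (ha : 0 < a) (hb : 1 ≤ b) (n : ℕ) : 0 < abWeights a b n := by
  rcases n with _ | n
  · simpa [abWeights] using ha
  · have hb' : 0 ≤ b - 1 := by linarith
    simp only [abWeights, Nat.succ_ne_zero, if_false, Real.sqrt_pos]
    push_cast
    rw [add_sub_cancel_right]
    positivity

theorem abWeights_bddAbove {a b : ℝ} (hb : 1 ≤ b) :
    BddAbove (Set.range (abWeights a b)) := by
  refine ⟨max √a √b, ?_⟩
  rintro _ ⟨n, rfl⟩
  rcases n with _ | n
  · simp [abWeights]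
  · have hb' : 0 ≤ b - 1 := by linarith
    refine le_trans ?_ (le_max_right _ _)
    simp only [abWeights, Nat.succ_ne_zero, if_false]
    push_cast
    rw [add_sub_cancel_right]
    refine Real.sqrt_le_sqrt ?_
    rw [div_le_iff₀ (by positivity)]
    nlinarith [mul_nonneg (Nat.cast_nonneg (α := ℝ) n) (mul_nonneg hb' hb')]

/-- The weighted shift `W_{a,b}` for `a ∈ (0,∞)` and `b ∈ [1,∞)`. -/
def shiftAB (a b : ℝ) (ha : 0 < a) (hb : 1 ≤ b) : Ell2 →L[ℂ] Ell2 :=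
  weightedShift (abWeights a b) (abWeights_pos ha hb) (abWeights_bddAbove hb)

end CPDShift

end

namespace CPDShift

open Finset

/-! Conditional positive definiteness makes the Hankel form of the second differences of `γ`
positive, so these satisfy a Cauchy–Schwarz inequality (`IsCPDSeq.secondDiff_sq_le`). For `γ n = ‖W
^ n e_m‖ ^ 2` the `j`-th second difference is a positive multiple of `beta w (m + j)`. Hence a zero
of `beta` at `m` or at `m + 2 * j` forces one at the midpoint `m + j`
(`beta_eq_zero_of_mul_eq_zero`): zeros spread upwards to all later indices, and downwards as far as
`1`.

As `defectOp 2 W` is diagonal with entries `beta w n`, the 2-isometry condition on the tail says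
that `beta` vanishes from `k` on. Vanishing from `1` on makes the products of squared weights
affine, which determines the weights. -/

theorem IsCPDSeq.nonneg_quadratic {γ : ℕ → ℝ} (h : IsCPDSeq γ) (j : ℕ) (s t : ℝ) :
    0 ≤ (γ 2 - 2 * γ 1 + γ 0) * s ^ 2 + 2 * (γ (j + 2) - 2 * γ (j + 1) + γ j) * s * t +
      (γ (2 * j + 2) - 2 * γ (2 * j + 1) + γ (2 * j)) * t ^ 2 := by
  -- `c = s(δ₁ - δ₀) + t(δ_{j+1} - δ_j)` has sum zero, and pairing with it takes first differences;
  -- doing so in both indices yields second differences.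
  let c : ℕ → ℝ := fun n => ((if n = 1 then s else 0) - (if n = 0 then s else 0)) +
    ((if n = j + 1 then t else 0) - (if n = j then t else 0))
  have hc : ∀ f : ℕ → ℝ, ∑ n ∈ range (j + 1 + 1), f n * c n =
      (f 1 - f 0) * s + (f (j + 1) - f j) * t := fun f => by
    simp [c, mul_add, mul_sub, sum_add_distrib, sum_sub_distrib]
    ring
  have h0 : ∑ n ∈ range (j + 1 + 1), c n = 0 := by
    simpa using hc fun _ => 1
  have h1 := h (j + 1) (fun n => (c n : ℂ)) (by
    rw [Fin.sum_univ_eq_sum_range (fun n => (c n : ℂ)), ← Complex.ofReal_sum, h0,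
      Complex.ofReal_zero])
  have h2 : (0 : ℝ) ≤ ∑ a ∈ range (j + 1 + 1), ∑ b ∈ range (j + 1 + 1),
      γ (a + b) * c a * c b := by
    rw [← Complex.zero_le_real]
    convert h1
    rw [← Fin.sum_univ_eq_sum_range (fun a => ∑ b ∈ range (j + 1 + 1), γ (a + b) * c a * c b)]
    push_cast
    refine sum_congr rfl fun a _ => ?_
    rw [← Fin.sum_univ_eq_sum_range (fun b => (γ (a + b) : ℂ) * c a * c b)]
    simp
  convert h2 using 1
  have hrow : ∀ a, ∑ b ∈ range (j + 1 + 1), γ (a + b) * c a * c b =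
      ((γ (a + 1) - γ a) * s + (γ (a + (j + 1)) - γ (a + j)) * t) * c a := fun a => by
    rw [hc fun b => γ (a + b) * c a, add_zero]
    ring
  rw [sum_congr rfl fun a _ => hrow a,
    hc fun a => (γ (a + 1) - γ a) * s + (γ (a + (j + 1)) - γ (a + j)) * t]
  ring_nf

theorem IsCPDSeq.secondDiff_nonneg {γ : ℕ → ℝ} (h : IsCPDSeq γ) : 0 ≤ γ 2 - 2 * γ 1 + γ 0 := by
  simpa using h.nonneg_quadratic 0 1 0

theorem IsCPDSeq.secondDiff_sq_le {γ : ℕ → ℝ} (h : IsCPDSeq γ) (j : ℕ) :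
    (γ (j + 2) - 2 * γ (j + 1) + γ j) ^ 2 ≤
      (γ 2 - 2 * γ 1 + γ 0) * (γ (2 * j + 2) - 2 * γ (2 * j + 1) + γ (2 * j)) := by
  have := discrim_le_zero (a := γ 2 - 2 * γ 1 + γ 0)
    (b := 2 * (γ (j + 2) - 2 * γ (j + 1) + γ j))
    (c := γ (2 * j + 2) - 2 * γ (2 * j + 1) + γ (2 * j)) fun s => by
      have := h.nonneg_quadratic j s 1
      linarith
  rw [discrim] at this
  linarith

/-! ### Zeros of `beta` and the shape of the weights. -/

section Shift

variable (w : ℕ → ℝ) (hpos : ∀ n, 0 < w n) (hbdd : BddAbove (Set.range w))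

theorem norm_stdBasis (n : ℕ) : ‖stdBasis n‖ = 1 := by
  simp [stdBasis, lp.norm_single]

theorem weightedShift_pow_stdBasis (m n : ℕ) :
    (weightedShift w hpos hbdd ^ n) (stdBasis m) =
      ((∏ i ∈ range n, w (m + i) : ℝ) : ℂ) • stdBasis (m + n) := by
  induction n with
  | zero => simp
  | succ n ih =>
    rw [pow_succ', mul_apply_eq_comp, ih, map_smul, weightedShift_stdBasis, smul_smul,
      prod_range_succ, Complex.ofReal_mul, add_assoc]

theorem norm_sq_weightedShift_pow_stdBasis (m n : ℕ) :
    ‖(weightedShift w hpos hbdd ^ n) (stdBasis m)‖ ^ 2 = ∏ i ∈ range n, w (m + i) ^ 2 := by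
  rw [weightedShift_pow_stdBasis, norm_smul, norm_stdBasis, mul_one, Complex.norm_real,
    Real.norm_eq_abs, sq_abs, prod_pow]

theorem secondDiff_prod_sq (m j : ℕ) :
    ∏ i ∈ range (j + 2), w (m + i) ^ 2 - 2 * ∏ i ∈ range (j + 1), w (m + i) ^ 2 +
      ∏ i ∈ range j, w (m + i) ^ 2 = (∏ i ∈ range j, w (m + i) ^ 2) * beta w (m + j) := by
  simp only [prod_range_succ, beta]
  ring_nf

variable {w hpos hbdd}

theorem beta_nonneg (h : IsCPDOperator (weightedShift w hpos hbdd)) (n : ℕ) :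
    0 ≤ beta w n := by
  have := (h (stdBasis n)).secondDiff_nonneg
  simp only [norm_sq_weightedShift_pow_stdBasis] at this
  rw [secondDiff_prod_sq w n 0] at this
  simpa using this

theorem prod_mul_beta_sq_le (h : IsCPDOperator (weightedShift w hpos hbdd)) (m j : ℕ) :
    ((∏ i ∈ range j, w (m + i) ^ 2) * beta w (m + j)) ^ 2 ≤
      beta w m * ((∏ i ∈ range (2 * j), w (m + i) ^ 2) * beta w (m + 2 * j)) := by
  have := (h (stdBasis m)).secondDiff_sq_le j
  simp only [norm_sq_weightedShift_pow_stdBasis] at this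
  have h0 := secondDiff_prod_sq w m 0
  simp only [prod_range_zero, one_mul, add_zero, zero_add] at h0 this
  rwa [h0, secondDiff_prod_sq, secondDiff_prod_sq] at this

theorem beta_eq_zero_of_mul_eq_zero (h : IsCPDOperator (weightedShift w hpos hbdd)) {m j : ℕ}
    (h0 : beta w m * beta w (m + 2 * j) = 0) : beta w (m + j) = 0 := by
  have h1 := prod_mul_beta_sq_le h m j
  rw [mul_left_comm, h0, mul_zero] at h1
  have h2 := pow_eq_zero_iff two_ne_zero |>.1 (le_antisymm h1 (sq_nonneg _))
  exact (mul_eq_zero.1 h2).resolve_left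
    (prod_pos fun i _ => pow_pos (hpos (m + i)) 2).ne'

theorem beta_eq_zero_of_le (h : IsCPDOperator (weightedShift w hpos hbdd)) {k j : ℕ}
    (hk : beta w k = 0) (hkj : k ≤ j) : beta w j = 0 := by
  obtain ⟨i, rfl⟩ := Nat.exists_eq_add_of_le hkj
  exact beta_eq_zero_of_mul_eq_zero h (by simp [hk])

theorem beta_one_eq_zero (h : IsCPDOperator (weightedShift w hpos hbdd)) {k : ℕ}
    (hk : beta w k = 0) : beta w 1 = 0 := by
  induction k with
  | zero => exact beta_eq_zero_of_le h hk zero_le_one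
  | succ k ih =>
    rcases k with _ | k
    · exact hk
    -- `k + 1` is the midpoint of `k` and `k + 2`. Index `0` is never a midpoint with `j = 1`, so
    -- the descent stops at `1`.
    · exact ih (beta_eq_zero_of_mul_eq_zero (m := k) (j := 1) h (by simp [hk]))

theorem sq_prod_eq_linear (hβ : ∀ j, 1 ≤ j → beta w j = 0) (n : ℕ) :
    ∏ i ∈ range n, w (1 + i) ^ 2 = 1 + n * (w 1 ^ 2 - 1) := by
  induction n using Nat.twoStepInduction with
  | zero => simp
  | one => simp
  | more n ih ih' =>
    have := secondDiff_prod_sq w 1 n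
    rw [hβ _ (Nat.le_add_right 1 n), mul_zero, ih, ih'] at this
    push_cast at this ⊢
    linarith

/-- An affine sequence that stays positive cannot have negative slope. -/
theorem one_le_sq_of_beta_eq_zero (hpos : ∀ n, 0 < w n) (hβ : ∀ j, 1 ≤ j → beta w j = 0) :
    1 ≤ w 1 ^ 2 := by
  by_contra! hlt
  obtain ⟨n, hn⟩ := Archimedean.arch 1 (sub_pos.2 hlt)
  have h1 := sq_prod_eq_linear hβ n
  have h2 : 0 < ∏ i ∈ range n, w (1 + i) ^ 2 := prod_pos fun i _ => pow_pos (hpos (1 + i)) 2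
  rw [nsmul_eq_mul] at hn
  linarith

theorem eq_abWeights (hpos : ∀ n, 0 < w n) (hβ : ∀ j, 1 ≤ j → beta w j = 0) :
    w = abWeights (w 0 ^ 2) (w 1 ^ 2) := by
  funext n
  rcases n with _ | n
  · simp [abWeights, Real.sqrt_sq (hpos 0).le]
  · have hb : 0 ≤ w 1 ^ 2 - 1 := sub_nonneg.2 (one_le_sq_of_beta_eq_zero hpos hβ)
    have h1 := sq_prod_eq_linear hβ (n + 1)
    rw [prod_range_succ, sq_prod_eq_linear hβ n] at h1
    simp only [abWeights, Nat.succ_ne_zero, if_false]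
    -- The squared weight is the ratio of two consecutive affine products.
    rw [eq_comm, Real.sqrt_eq_iff_eq_sq (by push_cast; rw [add_sub_cancel_right]; positivity)
      (hpos _).le, ← h1, Nat.cast_succ, add_sub_cancel_right,
      mul_div_cancel_left₀ _ (by positivity), add_comm 1 n]

theorem adjoint_weightedShift_stdBasis_succ (n : ℕ) :
    ContinuousLinearMap.adjoint (weightedShift w hpos hbdd) (stdBasis (n + 1)) =
      (w n : ℂ) • stdBasis n := by
  refine ext_inner_right ℂ fun y => ?_
  rw [ContinuousLinearMap.adjoint_inner_left, inner_smul_left]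
  simp [stdBasis, lp.inner_single_left, weightedShift_apply, shiftFun, mul_comm]

end Shift

/-! ### Defect operators of restrictions. -/

section Defect

theorem coe_restrict_pow_apply {H : Type*} [NormedAddCommGroup H] [InnerProductSpace ℂ H]
    {T : H →L[ℂ] H} {M : Submodule ℂ H} {hM : ∀ x ∈ M, T x ∈ M} (n : ℕ) (x : M) :
    (((T.restrict hM) ^ n) x : H) = (T ^ n) x := by
  induction n with
  | zero => simp
  | succ n ih => rw [pow_succ', pow_succ', mul_apply_eq_comp,
      mul_apply_eq_comp, ← ih]; rfl

variable {H : Type*} [NormedAddCommGroup H] [InnerProductSpace ℂ H] [CompleteSpace H]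

theorem inner_adjoint_pow_mul_pow (T : H →L[ℂ] H) (n : ℕ) (x y : H) :
    inner ℂ ((ContinuousLinearMap.adjoint T ^ n * T ^ n) x) y = inner ℂ ((T ^ n) x) ((T ^ n) y) := by
  rw [mul_apply_eq_comp, ← ContinuousLinearMap.star_eq_adjoint, ← star_pow,
    ContinuousLinearMap.star_eq_adjoint, ContinuousLinearMap.adjoint_inner_left]

theorem inner_defectOp_left (m : ℕ) (T : H →L[ℂ] H) (x y : H) :
    inner ℂ (defectOp m T x) y = ∑ n ∈ range (m + 1),
      ((-1 : ℂ) ^ n * (m.choose n : ℂ)) * inner ℂ ((T ^ n) x) ((T ^ n) y) := by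
  simp only [defectOp, _root_.sum_apply, sum_inner, _root_.smul_apply, inner_smul_left,
    inner_adjoint_pow_mul_pow]
  simp

variable {T : H →L[ℂ] H} {M : Submodule ℂ H} [CompleteSpace M] {hM : ∀ x ∈ M, T x ∈ M}

theorem inner_defectOp_restrict (m : ℕ) (x y : M) :
    inner ℂ (defectOp m (T.restrict hM) x) y = inner ℂ (defectOp m T x) (y : H) := by
  rw [inner_defectOp_left, inner_defectOp_left]
  simp only [Submodule.coe_inner, coe_restrict_pow_apply]

/-- The defect operator of a restriction is the compression of that of `T`; testing against inner
products avoids computing the adjoint of the restriction. -/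
theorem isMIsometry_restrict_iff (m : ℕ) :
    IsMIsometry m (T.restrict hM) ↔
      ∀ x ∈ M, ∀ y ∈ M, inner ℂ (defectOp m T x) y = 0 := by
  constructor
  · intro h x hx y hy
    rw [← inner_defectOp_restrict (hM := hM) m ⟨x, hx⟩ ⟨y, hy⟩, show defectOp m _ = 0 from h]
    simp
  · intro h
    refine ContinuousLinearMap.ext fun x => ext_inner_right ℂ fun y => ?_
    rw [inner_defectOp_restrict, h x x.2 y y.2]
    simp

end Defect

theorem defectOp_two_weightedShift_stdBasis {w : ℕ → ℝ} (hpos : ∀ n, 0 < w n)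
    (hbdd : BddAbove (Set.range w)) (n : ℕ) :
    defectOp 2 (weightedShift w hpos hbdd) (stdBasis n) = (beta w n : ℂ) • stdBasis n := by
  simp only [defectOp, sum_range_succ, range_zero, sum_empty, _root_.add_apply,
    _root_.smul_apply, mul_apply_eq_comp, pow_zero, pow_one, pow_two,
    weightedShift_stdBasis, map_smul, adjoint_weightedShift_stdBasis_succ, smul_smul, beta,
    one_apply_eq_self, zero_add, ← add_smul]
  congr 1
  push_cast [Nat.choose]
  ring

theorem isMIsometry_restrict_tailSpace_iff {w : ℕ → ℝ} (hpos : ∀ n, 0 < w n)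
    (hbdd : BddAbove (Set.range w)) (k : ℕ) :
    IsMIsometry 2 ((weightedShift w hpos hbdd).restrict
      (weightedShift_mem_tailSpace w hpos hbdd k)) ↔ ∀ j, k ≤ j → beta w j = 0 := by
  rw [isMIsometry_restrict_iff]
  constructor
  · intro h j hj
    have hmem : stdBasis j ∈ tailSpace k :=
      Submodule.le_topologicalClosure _ (Submodule.subset_span ⟨j, hj, rfl⟩)
    have := h _ hmem _ hmem
    rw [defectOp_two_weightedShift_stdBasis, inner_smul_left, inner_self_eq_norm_sq_to_K,
      norm_stdBasis] at this
    simpa using this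
  · intro h x hx y _
    have hle : tailSpace k ≤ (defectOp 2 (weightedShift w hpos hbdd)).ker := by
      refine Submodule.topologicalClosure_minimal _ (Submodule.span_le.2 ?_)
        (ContinuousLinearMap.isClosed_ker _)
      rintro _ ⟨j, hj, rfl⟩
      simp [defectOp_two_weightedShift_stdBasis, h j hj]
    have h0 : defectOp 2 (weightedShift w hpos hbdd) x = 0 := hle hx
    rw [h0, inner_zero_left]

end CPDShift

theorem proposition2p15 (lam : ℕ → ℝ) (hpos : ∀ n, 0 < lam n)
    (hbdd : BddAbove (Set.range lam))
    (hCPD : CPDShift.IsCPDOperator (CPDShift.weightedShift lam hpos hbdd)) (k : ℕ) :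
    (CPDShift.beta lam k = 0 ↔
      CPDShift.IsMIsometry 2 ((CPDShift.weightedShift lam hpos hbdd).restrict
        (CPDShift.weightedShift_mem_tailSpace lam hpos hbdd k))) ∧
    (CPDShift.beta lam k = 0 →
      (∀ j : ℕ, 1 ≤ j → CPDShift.beta lam j = 0) ∧
      ∃ (a b : ℝ) (ha : 0 < a) (hb : 1 ≤ b),
        0 ≤ 1 - 2 * a + a * b ∧
          CPDShift.weightedShift lam hpos hbdd = CPDShift.shiftAB a b ha hb) := by
  refine ⟨?_, fun hk => ?_⟩
  · rw [CPDShift.isMIsometry_restrict_tailSpace_iff]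
    exact ⟨fun hk j hj => CPDShift.beta_eq_zero_of_le hCPD hk hj, fun h => h k le_rfl⟩
  · have hβ : ∀ j : ℕ, 1 ≤ j → CPDShift.beta lam j = 0 := fun j hj =>
      CPDShift.beta_eq_zero_of_le hCPD (CPDShift.beta_one_eq_zero hCPD hk) hj
    -- With these `a` and `b`, `1 - 2 * a + a * b` is exactly `beta lam 0`.
    refine ⟨hβ, lam 0 ^ 2, lam 1 ^ 2, pow_pos (hpos 0) 2,
      CPDShift.one_le_sq_of_beta_eq_zero hpos hβ, CPDShift.beta_nonneg hCPD 0, ?_⟩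
    unfold CPDShift.shiftAB
    congr 1
    exact CPDShift.eq_abWeights hpos hβ
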